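/- Let $\mu>1$. Let $\mathcal P(\mathbb N)$ be the set of probability distributions on $\mathbb N=\{0,1,2,\dots\}$, let $$\mathcal S_\mu=\Big\{\mathbf p\in\mathcal P(\mathbb N)\ :\ \sum_{n\ge 0} n\,p_n=\mu\Big\},$$ and let $\bar{\mathbf p}$ be the modified Poisson distribution $$\bar p_0=0,\qquad \bar p_n=\frac{(\mu-1)^{n-1}}{(n-1)!}\,e^{-(\mu-1)}\quad (n\ge 1).$$ Let $\mathcal H$ be the space of all $\mathbf p\in\ell^2(\mathbb N)$ with $$\|\mathbf p\|_{\mathcal H}^2:=p_0^2+\sum_{n\ge 1}\frac{p_n^2}{\bar p_n}<\infty .$$ A solution is a map $\mathbf p:[0,\infty)\to\mathcal P(\mathbb N)$ whose components are differentiable on $[0,\infty)$ (one-sidedly at $0$) and satisfy, for all $t\ge 0$, $$p_0'=-(\mu-1)\,p_0-p_0^2,$$ $$p_n'=n\,p_{n+1}+(\mu-1)\,p_{n-1}-(n-1)\,p_n-(\mu-1)\,p_n-p_0\,(p_n-p_{n-1})\qquad (n\ge 1).$$ Theorem. For every $\mu>1$ and every $R\in\mathbb R$ there is a constant $C>0$,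 depending only on $\mu$ and $R$, such that every solution $\mathbf p$ with $\mathbf p(0)\in\mathcal S_\mu\cap\mathcal H$ and $\|\mathbf p(0)-\bar{\mathbf p}\|_{\mathcal H}\le R$ satisfies, for all $t\ge 0$, $\mathbf p(t)-\bar{\mathbf p}\in\mathcal H$ and $$\|\mathbf p(t)-\bar{\mathbf p}\|_{\mathcal H}^2\le\begin{cases} C\,(1+t)\,e^{-(\mu-1)t} & \text{if } 1<\mu<3,\\ C\,(1+t)^2\,e^{-2t} & \text{if } \mu=3,\\ C\,e^{-2t} & \text{if } \mu>3.\end{cases}$$ In particular $\|\mathbf p(t)-\bar{\mathbf p}\|_{\mathcal H}\to 0$ as $t\to\infty$. -/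

import Mathlib

open Filter Topology

noncomputable section

namespace StickyDispersion

/-- A probability distribution on `ℕ`: nonnegative entries with total mass one. -/
def IsProb (p : ℕ → ℝ) : Prop :=
  (∀ n, 0 ≤ p n) ∧ HasSum p 1

/-- The space of probability distributions on `ℕ` with mean value `μ`. -/
def probWithMean (μ : ℝ) : Set (ℕ → ℝ) :=
  {p | IsProb p ∧ HasSum (fun n : ℕ => (n : ℝ) * p n) μ}

/-- The modified Poisson distribution (the law of `1 + Y` with `Y` Poisson of mean `μ - 1`). -/
def pbar (μ : ℝ) : ℕ → ℝ
  | 0 => 0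
  | n + 1 => (μ - 1) ^ n / (n.factorial : ℝ) * Real.exp (-(μ - 1))

/-- The linear operator `Q̂`. In the second clause the component is the one of index `n + 1`. -/
def Qhat (μ : ℝ) (p : ℕ → ℝ) : ℕ → ℝ
  | 0 => -(μ - 1) * p 0
  | n + 1 => ((n : ℝ) + 1) * p (n + 2) + (μ - 1) * p n - (n : ℝ) * p (n + 1) - (μ - 1) * p (n + 1)

/-- The right shift `R[p]₀ = 0`, `R[p]ₙ = pₙ₋₁`. -/
def shift (p : ℕ → ℝ) : ℕ → ℝ
  | 0 => 0
  | n + 1 => p n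

/-- The backward difference `D⁻[p] = p - R[p]`. -/
def Dminus (p : ℕ → ℝ) : ℕ → ℝ := p - shift p

/-- `p` solves `p' = Q̂[p] - p₀ D⁻[p]` on `[0, ∞)`: it is a curve of probability distributions
whose components are differentiable (one-sidedly at `t = 0`) and satisfy the system.
The values of `p` at negative times play no role. -/
structure IsSolution (μ : ℝ) (p : ℝ → ℕ → ℝ) : Prop where
  isProb : ∀ t, 0 ≤ t → IsProb (p t)
  hasDeriv : ∀ t, 0 ≤ t → ∀ n, HasDerivWithinAt (fun s => p s n)
    (Qhat μ (p t) n - p t 0 * Dminus (p t) n) (Set.Ici 0) t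

/-- The space `𝓗` of square-summable sequences `p` with `p₀² + ∑_{n ≥ 1} pₙ² / p̄ₙ < ∞`. -/
def spaceH (μ : ℝ) : Set (ℕ → ℝ) :=
  {p | Memℓp (E := fun _ : ℕ => ℝ) p 2 ∧ Summable (fun n : ℕ => p (n + 1) ^ 2 / pbar μ (n + 1))}

/-- The scalar product of `𝓗` (meaningful for `p` and `q` in `spaceH μ`). -/
def innerH (μ : ℝ) (p q : ℕ → ℝ) : ℝ :=
  p 0 * q 0 + ∑' n : ℕ, p (n + 1) * q (n + 1) / pbar μ (n + 1)

/-- The norm of `𝓗` (meaningful for `p` in `spaceH μ`). -/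
def normH (μ : ℝ) (p : ℕ → ℝ) : ℝ :=
  Real.sqrt (innerH μ p p)

end StickyDispersion

end

noncomputable section

namespace StickyDispersion

/-! Put ν = μ - 1, x = p_0 and q_k = p_{k+1}. The Charlier coefficients c_j of q relative to the
Poisson law of mean ν satisfy e^{-νw} ∑ q_k (1+w)^k = ∑ c_j w^j. In these coordinates the system is
lower triangular: c_j' = -j c_j + x c_{j-1} + (ν+x) x (-ν)^j/j! for j ≥ 1, while x' = -(ν+x)x gives
x ≤ e^{-νt}. Mass and mean give c_0 = 1 - x and c_1 = (ν+1)x, so only degrees j ≥ 2 need an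
estimate. There the damping makes ∑ (j!/ν^j) c_j² decay like e^{-min(ν,2)t}
(`energy_coeffCurve_le`), which implies all three stated bounds.

A solution is controlled only componentwise, so neither the moments nor the norm of p(t) can be
differentiated directly. Instead the hierarchy is solved from the initial coefficients
(`coeffCurve`), and truncated generating functions are compared with truncated expansions along the
characteristics w' = w. The truncation errors vanish, and Grönwall identifies the limits
(`IsSolution.tendsto_genDiff`). Uniqueness of power series then recovers q from the c_j.
Completeness of the Charlier system is not needed, only that k ↦ z^k lies in its closed span
(`charlierIso_powCoeff`). -/

/-! ### Poisson weights and Charlier polynomials -/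

/-- The Poisson weights of mean `ν`. -/
def pois (ν : ℝ) (k : ℕ) : ℝ := ν ^ k / (k.factorial : ℝ) * Real.exp (-ν)

/-- The Charlier polynomials, normalised by `C₀ = 1` and `Cⱼ₊₁(k) = (k / ν) Cⱼ(k - 1) - Cⱼ(k)`. -/
def charlier (ν : ℝ) : ℕ → ℕ → ℝ
  | 0, _ => 1
  | j + 1, k => (k : ℝ) / ν * charlier ν j (k - 1) - charlier ν j k

theorem charlier_succ (ν : ℝ) (j k : ℕ) :
    charlier ν (j + 1) k = (k : ℝ) / ν * charlier ν j (k - 1) - charlier ν j k := rfl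

/-- The squared norm `j! / νʲ` of the `j`-th Charlier polynomial. -/
def charlierSq (ν : ℝ) (j : ℕ) : ℝ := (j.factorial : ℝ) / ν ^ j

variable {ν : ℝ}

theorem hasSum_of_forall_eq {f g : ℕ → ℝ} {a b : ℝ} (h : HasSum f a) (hf : ∀ k, g k = f k)
    (hb : b = a) : HasSum g b := by
  rwa [funext hf, hb]

theorem pois_pos (hν : 0 < ν) (k : ℕ) : 0 < pois ν k := by
  unfold pois; positivity

theorem charlierSq_pos (hν : 0 < ν) (j : ℕ) : 0 < charlierSq ν j := by
  unfold charlierSq; positivity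

theorem charlierSq_succ (hν : 0 < ν) (j : ℕ) :
    charlierSq ν (j + 1) = ((j : ℝ) + 1) / ν * charlierSq ν j := by
  unfold charlierSq
  rw [Nat.factorial_succ, pow_succ]
  push_cast
  field_simp

theorem succ_div_mul_pois_succ (hν : 0 < ν) (k : ℕ) :
    ((k : ℝ) + 1) / ν * pois ν (k + 1) = pois ν k := by
  unfold pois
  rw [Nat.factorial_succ, pow_succ]
  push_cast
  field_simp

theorem hasSum_pois_mul_pow (ν z : ℝ) :
    HasSum (fun k => pois ν k * z ^ k) (Real.exp (ν * (z - 1))) := by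
  have h := (NormedSpace.expSeries_div_hasSum_exp (𝔸 := ℝ) (ν * z)).mul_right (Real.exp (-ν))
  rw [← Real.exp_eq_exp_ℝ, ← Real.exp_add] at h
  refine hasSum_of_forall_eq h (fun k => ?_) ?_
  · unfold pois; rw [mul_pow]; ring
  · congr 1; ring

theorem hasSum_pois (ν : ℝ) : HasSum (pois ν) 1 := by
  simpa using hasSum_pois_mul_pow ν 1

/-- Geometrically bounded functions on `ℕ`. -/
def GeomBdd (f : ℕ → ℝ) : Prop := ∃ A r : ℝ, 0 ≤ A ∧ 0 ≤ r ∧ ∀ k, |f k| ≤ A * r ^ k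

theorem GeomBdd.mul {f g : ℕ → ℝ} (hf : GeomBdd f) (hg : GeomBdd g) :
    GeomBdd fun k => f k * g k := by
  obtain ⟨A, r, hA, hr, h⟩ := hf
  obtain ⟨B, s, hB, hs, h'⟩ := hg
  refine ⟨A * B, r * s, by positivity, by positivity, fun k => ?_⟩
  rw [abs_mul, mul_pow, mul_mul_mul_comm]
  exact mul_le_mul (h k) (h' k) (abs_nonneg _) (by positivity)

theorem geomBdd_pow (z : ℝ) : GeomBdd fun k => z ^ k :=
  ⟨1, |z|, by positivity, by positivity, fun k => by simp⟩

theorem GeomBdd.summable (hν : 0 < ν) {f : ℕ → ℝ} (hf : GeomBdd f) :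
    Summable fun k => pois ν k * f k := by
  obtain ⟨A, r, hA, hr, h⟩ := hf
  refine Summable.of_norm_bounded ((hasSum_pois_mul_pow ν r).summable.mul_left A) fun k => ?_
  rw [norm_mul, Real.norm_eq_abs, Real.norm_eq_abs, abs_of_pos (pois_pos hν k)]
  nlinarith [h k, pois_pos hν k]

theorem abs_charlier_le (hν : 0 < ν) (j k : ℕ) :
    |charlier ν j k| ≤ (1 + (k : ℝ) / ν) ^ j := by
  induction j generalizing k with
  | zero => simp [charlier]
  | succ j ih =>
    have h1 : |charlier ν j (k - 1)| ≤ (1 + (k : ℝ) / ν) ^ j := by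
      refine (ih (k - 1)).trans ?_
      gcongr
      exact Nat.sub_le k 1
    have h0 : (0 : ℝ) ≤ (k : ℝ) / ν := by positivity
    rw [charlier]
    refine (abs_sub _ _).trans ?_
    rw [abs_mul, abs_of_nonneg h0, pow_succ]
    nlinarith [ih k, mul_le_mul_of_nonneg_left h1 h0]

theorem geomBdd_charlier (hν : 0 < ν) (j : ℕ) : GeomBdd (charlier ν j) := by
  -- The constants come from y^j ≤ j! e^y at y = 1 + k/ν.
  refine ⟨j.factorial * Real.exp 1, Real.exp (1 / ν), by positivity, by positivity, fun k => ?_⟩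
  refine (abs_charlier_le hν j k).trans ?_
  have h := Real.pow_div_factorial_le_exp (1 + (k : ℝ) / ν) (by positivity) j
  rw [div_le_iff₀ (by positivity)] at h
  refine h.trans (le_of_eq ?_)
  rw [← Real.exp_nat_mul, Real.exp_add, show (k : ℝ) / ν = k * (1 / ν) by ring]
  ring

/-- The forward difference of a Charlier polynomial. -/
theorem charlier_succ_sub (hν : 0 < ν) (j k : ℕ) :
    charlier ν (j + 1) (k + 1) - charlier ν (j + 1) k
      = ((j : ℝ) + 1) / ν * charlier ν j k := by
  induction j generalizing k with
  | zero => simp [charlier]; field_simp; ring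
  | succ j ih =>
    have e1 := ih k
    rw [charlier_succ ν (j + 1) (k + 1), charlier_succ ν (j + 1) k, Nat.add_sub_cancel]
    -- At k = 0 the truncated `k - 1` spoils the recurrence one step down, so this case is separate.
    rcases k with _ | k
    · have e2 : charlier ν (j + 1) 0 = - charlier ν j 0 := by simp [charlier]
      push_cast at *
      simp only [zero_div, zero_mul] at *
      rw [e2] at e1 ⊢
      have e3 : charlier ν (j + 1) 1 = (j + 1) / ν * charlier ν j 0 - charlier ν j 0 := by
        linarith
      rw [e3]; ring
    · rw [Nat.add_sub_cancel]
      have e2 := ih k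
      have e3 : charlier ν (j + 1) (k + 1)
        = ((k : ℝ) + 1) / ν * charlier ν j k - charlier ν j (k + 1) := by
        rw [charlier]; push_cast; simp
      have e4 : charlier ν (j + 1) (k + 1 + 1)
        = charlier ν (j + 1) (k + 1) + ((j : ℝ) + 1) / ν * charlier ν j (k + 1) := by linarith
      have e5 : charlier ν (j + 1) k
        = charlier ν (j + 1) (k + 1) - ((j : ℝ) + 1) / ν * charlier ν j k := by linarith
      rw [e4, e5]
      push_cast
      linear_combination (-((j : ℝ) + 1) / ν) * e3

/-- The raising operator is adjoint to the forward difference. -/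
theorem hasSum_charlier_succ_mul (hν : 0 < ν) (j : ℕ) {f : ℕ → ℝ} (hf : GeomBdd f) {a : ℝ}
    (h : HasSum (fun k => pois ν k * (charlier ν j k * (f (k + 1) - f k))) a) :
    HasSum (fun k => pois ν k * (charlier ν (j + 1) k * f k)) a := by
  have s0 := ((geomBdd_charlier hν j).mul hf).summable hν
  have s1 := h.add s0.hasSum
  have s2 : HasSum (fun k => pois ν k * ((k : ℝ) / ν * charlier ν j (k - 1) * f k))
      (a + ∑' k, pois ν k * (charlier ν j k * f k)) := by
    -- The factor k kills the term k = 0, where `k - 1` is truncated; shifting the index and using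
    -- (k+1)/ν · π_{k+1} = π_k is the summation by parts.
    rw [← hasSum_nat_add_iff' 1]
    refine hasSum_of_forall_eq s1 (fun k => ?_) ?_
    · rw [← succ_div_mul_pois_succ hν k]
      simp only [Nat.add_sub_cancel]
      push_cast
      ring
    · simp
  refine hasSum_of_forall_eq (s2.sub s0.hasSum) (fun k => ?_) ?_
  · simp only [charlier]; ring
  · ring

/-- The forward difference of z^k is (z-1) z^k, so each raising step contributes one factor z - 1.
-/
theorem hasSum_charlier_mul_pow (hν : 0 < ν) (j : ℕ) (z : ℝ) :
    HasSum (fun k => pois ν k * (charlier ν j k * z ^ k))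
      (Real.exp (ν * (z - 1)) * (z - 1) ^ j) := by
  induction j with
  | zero => simpa [charlier] using hasSum_pois_mul_pow ν z
  | succ j ih =>
    apply hasSum_charlier_succ_mul hν j (geomBdd_pow z)
    exact hasSum_of_forall_eq (ih.mul_right (z - 1)) (fun k => by ring) (by ring)

/-- Adjointness trades a raising operator on one factor for a difference on the other, lowering both
degrees by one. It ends at degree zero, where the difference of a constant vanishes. -/
theorem hasSum_charlier_mul_charlier (hν : 0 < ν) (i j : ℕ) :
    HasSum (fun k => pois ν k * (charlier ν i k * charlier ν j k))
      (if i = j then charlierSq ν i else 0) := by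
  have h0 : ∀ j, HasSum (fun k => pois ν k * (charlier ν (j + 1) k * charlier ν 0 k)) 0 := by
    intro j
    apply hasSum_charlier_succ_mul hν j (geomBdd_charlier hν 0)
    simp [charlier, hasSum_zero]
  induction i generalizing j with
  | zero =>
    rcases j with _ | j
    · simpa [charlier, charlierSq] using hasSum_pois ν
    · simpa [mul_comm] using h0 j
  | succ i ih =>
    rcases j with _ | j
    · simpa using h0 i
    · apply hasSum_charlier_succ_mul hν i (geomBdd_charlier hν (j + 1))
      simp only [charlier_succ_sub hν]
      refine hasSum_of_forall_eq ((ih j).mul_left (((j : ℝ) + 1) / ν)) (fun k => by ring) ?_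
      by_cases hij : i = j
      · subst hij; simp [charlierSq_succ hν]
      · simp [hij]

/-! ### Charlier expansions in ℓ² -/

/-- A square-summable real sequence as an element of `ℓ²`. -/
def l2Of (f : ℕ → ℝ) (hf : Summable fun k => f k ^ 2) : lp (fun _ : ℕ => ℝ) 2 :=
  ⟨f, memℓp_gen (by simpa using hf)⟩

theorem l2Of_apply (f : ℕ → ℝ) (hf : Summable fun k => f k ^ 2) (k : ℕ) :
    (l2Of f hf : ℕ → ℝ) k = f k := rfl

theorem hasSum_mul_inner (f g : lp (fun _ : ℕ => ℝ) 2) :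
    HasSum (fun k => f k * g k) (inner ℝ f g) :=
  hasSum_of_forall_eq (lp.hasSum_inner f g) (fun k => by simp [mul_comm]) rfl

theorem hasSum_sq_norm (f : lp (fun _ : ℕ => ℝ) 2) :
    HasSum (fun k => f k ^ 2) (‖f‖ ^ 2) := by
  rw [← real_inner_self_eq_norm_sq]
  exact hasSum_of_forall_eq (hasSum_mul_inner f f) (fun k => sq _) rfl

theorem inner_eq_of_hasSum {f g : lp (fun _ : ℕ => ℝ) 2} {a : ℝ}
    (h : HasSum (fun k => f k * g k) a) : inner ℝ f g = a :=
  (hasSum_mul_inner f g).unique h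

/-- The normalised Charlier functions, as elements of `ℓ²`. -/
def charlierVec (hν : 0 < ν) (j : ℕ) : lp (fun _ : ℕ => ℝ) 2 :=
  l2Of (fun k => √(pois ν k) * charlier ν j k / √(charlierSq ν j)) (by
    refine ((hasSum_charlier_mul_charlier hν j j).mul_right (charlierSq ν j)⁻¹).summable.congr
      fun k => ?_
    rw [div_pow, mul_pow, Real.sq_sqrt (pois_pos hν k).le, Real.sq_sqrt (charlierSq_pos hν j).le]
    ring)

theorem charlierVec_apply (hν : 0 < ν) (j k : ℕ) :
    charlierVec hν j k = √(pois ν k) * charlier ν j k / √(charlierSq ν j) := rfl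

theorem orthonormal_charlierVec (hν : 0 < ν) : Orthonormal ℝ (charlierVec hν) := by
  rw [orthonormal_iff_ite]
  intro i j
  apply inner_eq_of_hasSum
  refine hasSum_of_forall_eq ((hasSum_charlier_mul_charlier hν i j).mul_right
    (√(charlierSq ν i) * √(charlierSq ν j))⁻¹) (fun k => ?_) ?_
  · rw [charlierVec_apply, charlierVec_apply]
    have := Real.mul_self_sqrt (pois_pos hν k).le
    have h1 := Real.sqrt_pos.2 (charlierSq_pos hν i)
    have h2 := Real.sqrt_pos.2 (charlierSq_pos hν j)
    field_simp
    linear_combination (charlier ν i k * charlier ν j k) * this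
  · by_cases h : i = j
    · subst h
      have := charlierSq_pos hν i
      simp [Real.mul_self_sqrt this.le, this.ne']
    · simp [h]

/-- The representer of the evaluation of generating functions at `z`. -/
def powVec (hν : 0 < ν) (z : ℝ) : lp (fun _ : ℕ => ℝ) 2 :=
  l2Of (fun k => √(pois ν k) * z ^ k) (by
    refine (hasSum_pois_mul_pow ν (z ^ 2)).summable.congr fun k => ?_
    rw [mul_pow, Real.sq_sqrt (pois_pos hν k).le]
    ring)

theorem powVec_apply (hν : 0 < ν) (z : ℝ) (k : ℕ) :
    powVec hν z k = √(pois ν k) * z ^ k := rfl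

/-- The Charlier coefficients of `powVec`. -/
def powCoeff (ν z : ℝ) (j : ℕ) : ℝ :=
  Real.exp (ν * (z - 1)) * (z - 1) ^ j / √(charlierSq ν j)

/-- Since 2(z-1) + (z-1)² = z² - 1, the value is the squared norm of `powVec`: Bessel's inequality
is an equality for this vector. -/
theorem hasSum_powCoeff_sq (hν : 0 < ν) (z : ℝ) :
    HasSum (fun j => powCoeff ν z j ^ 2) (Real.exp (ν * (z ^ 2 - 1))) := by
  have h := (hasSum_pois_mul_pow ν ((z - 1) ^ 2)).mul_right
    (Real.exp (ν * (z - 1)) ^ 2 * Real.exp ν)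
  refine hasSum_of_forall_eq h (fun j => ?_) ?_
  · rw [powCoeff, div_pow, Real.sq_sqrt (charlierSq_pos hν j).le, charlierSq, pois, Real.exp_neg]
    have := Real.exp_pos ν
    rw [← pow_mul, mul_comm 2 j, mul_pow, ← pow_mul]
    field_simp
  · rw [← Real.exp_nat_mul, ← Real.exp_add, ← Real.exp_add]
    congr 1; push_cast; ring

theorem inner_charlierVec_powVec (hν : 0 < ν) (j : ℕ) (z : ℝ) :
    inner ℝ (charlierVec hν j) (powVec hν z) = powCoeff ν z j := by
  apply inner_eq_of_hasSum
  refine hasSum_of_forall_eq ((hasSum_charlier_mul_pow hν j z).mul_right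
    (√(charlierSq ν j))⁻¹) (fun k => ?_) ?_
  · rw [charlierVec_apply, powVec_apply]
    have := Real.mul_self_sqrt (pois_pos hν k).le
    have h1 := Real.sqrt_pos.2 (charlierSq_pos hν j)
    field_simp
    linear_combination (charlier ν j k * z ^ k) * this
  · rw [powCoeff]; ring

/-- The isometry of `ℓ²` that sends the `j`-th unit vector to `charlierVec hν j`. -/
def charlierIso (hν : 0 < ν) : lp (fun _ : ℕ => ℝ) 2 →ₗᵢ[ℝ] lp (fun _ : ℕ => ℝ) 2 :=
  (orthonormal_charlierVec hν).orthogonalFamily.linearIsometry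

theorem hasSum_charlierIso (hν : 0 < ν) (a : lp (fun _ : ℕ => ℝ) 2) :
    HasSum (fun j => a j • charlierVec hν j) (charlierIso hν a) := by
  have h := (orthonormal_charlierVec hν).orthogonalFamily.hasSum_linearIsometry a
  simp only [LinearIsometry.toSpanSingleton_apply] at h
  exact h

theorem hasSum_inner_charlierIso (hν : 0 < ν) (a u : lp (fun _ : ℕ => ℝ) 2) :
    HasSum (fun j => a j * inner ℝ (charlierVec hν j) u) (inner ℝ (charlierIso hν a) u) := by
  have h := (hasSum_charlierIso hν a).mapL (innerSL ℝ u)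
  refine hasSum_of_forall_eq h (fun j => ?_) ?_
  · simp [real_inner_comm]
  · simp [real_inner_comm]

/-- `powVec` is the sum of its Charlier expansion. -/
theorem charlierIso_powCoeff (hν : 0 < ν) (z : ℝ) :
    charlierIso hν (l2Of (powCoeff ν z) (hasSum_powCoeff_sq hν z).summable) = powVec hν z := by
  set a := l2Of (powCoeff ν z) (hasSum_powCoeff_sq hν z).summable with ha
  have h1 : ‖a‖ ^ 2 = Real.exp (ν * (z ^ 2 - 1)) :=
    (hasSum_sq_norm a).unique (hasSum_powCoeff_sq hν z)
  have h2 : ‖powVec hν z‖ ^ 2 = Real.exp (ν * (z ^ 2 - 1)) := by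
    refine (hasSum_sq_norm _).unique
      (hasSum_of_forall_eq (hasSum_pois_mul_pow ν (z ^ 2)) (fun k => ?_) rfl)
    rw [powVec_apply, mul_pow, Real.sq_sqrt (pois_pos hν k).le]
    ring
  have h3 : inner ℝ (charlierIso hν a) (powVec hν z) = Real.exp (ν * (z ^ 2 - 1)) := by
    refine (hasSum_inner_charlierIso hν a _).unique
      (hasSum_of_forall_eq (hasSum_powCoeff_sq hν z) (fun k => ?_) rfl)
    rw [inner_charlierVec_powVec, ha, l2Of_apply]
    ring
  -- In ‖Ua - v‖² = ‖a‖² - 2⟨Ua, v⟩ + ‖v‖² both squared norms and the inner product equal exp(ν(z² -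
  -- 1)).
  rw [← sub_eq_zero, ← norm_eq_zero, ← sq_eq_zero_iff, @norm_sub_sq_real,
    LinearIsometry.norm_map, h1, h2, h3]
  ring

/-- The coefficients of `q / pois ν` in the Charlier polynomials. -/
def charlierCoeff (ν : ℝ) (q : ℕ → ℝ) (j : ℕ) : ℝ :=
  (∑' k, q k * charlier ν j k) / charlierSq ν j

theorem summable_div_sqrt_pois (hν : 0 < ν) {q : ℕ → ℝ}
    (hq : Summable fun k => q k ^ 2 / pois ν k) :
    Summable fun k => (q k / √(pois ν k)) ^ 2 :=
  hq.congr fun k => by rw [div_pow, Real.sq_sqrt (pois_pos hν k).le]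

theorem inner_charlierVec_div_sqrt_pois (hν : 0 < ν) {q : ℕ → ℝ}
    (hq : Summable fun k => q k ^ 2 / pois ν k) (j : ℕ) :
    inner ℝ (charlierVec hν j) (l2Of _ (summable_div_sqrt_pois hν hq))
      = √(charlierSq ν j) * charlierCoeff ν q j := by
  have h1 := Real.sqrt_pos.2 (charlierSq_pos hν j)
  have h := hasSum_mul_inner (charlierVec hν j) (l2Of _ (summable_div_sqrt_pois hν hq))
  have h' : HasSum (fun k => q k * charlier ν j k)
      (√(charlierSq ν j) * inner ℝ (charlierVec hν j) (l2Of _ (summable_div_sqrt_pois hν hq))) := by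
    refine hasSum_of_forall_eq (h.mul_left (√(charlierSq ν j))) (fun k => ?_) rfl
    have h2 := Real.sqrt_pos.2 (pois_pos hν k)
    rw [charlierVec_apply, l2Of_apply]
    field_simp
  rw [charlierCoeff, h'.tsum_eq]
  have := Real.mul_self_sqrt (charlierSq_pos hν j).le
  have h3 := charlierSq_pos hν j
  field_simp
  linear_combination (-inner ℝ (charlierVec hν j) (l2Of _ (summable_div_sqrt_pois hν hq))) * this

/-- Bessel's inequality; it bounds the initial energy by the weighted norm of the data. -/
theorem sum_charlierSq_mul_coeff_sq_le (hν : 0 < ν) {q : ℕ → ℝ}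
    (hq : Summable fun k => q k ^ 2 / pois ν k) (s : Finset ℕ) :
    ∑ j ∈ s, charlierSq ν j * charlierCoeff ν q j ^ 2 ≤ ∑' k, q k ^ 2 / pois ν k := by
  have h := (orthonormal_charlierVec hν).sum_inner_products_le
    (l2Of _ (summable_div_sqrt_pois hν hq)) (s := s)
  have e : ‖l2Of _ (summable_div_sqrt_pois hν hq)‖ ^ 2 = ∑' k, q k ^ 2 / pois ν k := by
    rw [← (hasSum_sq_norm _).tsum_eq]
    congr 1; ext k
    rw [l2Of_apply, div_pow, Real.sq_sqrt (pois_pos hν k).le]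
  rw [e] at h
  refine le_trans (le_of_eq (Finset.sum_congr rfl fun j _ => ?_)) h
  rw [inner_charlierVec_div_sqrt_pois hν hq, Real.norm_eq_abs, sq_abs, mul_pow,
    Real.sq_sqrt (charlierSq_pos hν j).le]

/-- Pair q/√π with the Charlier expansion of `powVec`; no expansion of q itself is needed. -/
theorem hasSum_charlierCoeff_mul_pow (hν : 0 < ν) {q : ℕ → ℝ}
    (hq : Summable fun k => q k ^ 2 / pois ν k) (z : ℝ) :
    HasSum (fun j => charlierCoeff ν q j * (z - 1) ^ j)
      (Real.exp (-(ν * (z - 1))) * ∑' k, q k * z ^ k) := by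
  set u := l2Of _ (summable_div_sqrt_pois hν hq) with hu
  have h := hasSum_inner_charlierIso hν
    (l2Of (powCoeff ν z) (hasSum_powCoeff_sq hν z).summable) u
  rw [charlierIso_powCoeff] at h
  have e : inner ℝ (powVec hν z) u = ∑' k, q k * z ^ k := by
    rw [← (hasSum_mul_inner _ _).tsum_eq]
    congr 1; ext k
    have h2 := Real.sqrt_pos.2 (pois_pos hν k)
    rw [powVec_apply, hu, l2Of_apply]
    field_simp
  rw [e] at h
  refine hasSum_of_forall_eq (h.mul_left (Real.exp (-(ν * (z - 1))))) (fun j => ?_) rfl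
  have h1 := Real.sqrt_pos.2 (charlierSq_pos hν j)
  rw [inner_charlierVec_div_sqrt_pois hν hq, l2Of_apply, powCoeff, Real.exp_neg]
  have := Real.exp_pos (ν * (z - 1))
  field_simp

/-- A sequence with prescribed square-summable Charlier coefficients. -/
theorem exists_hasSum_sq_div_pois (hν : 0 < ν) {c : ℕ → ℝ}
    (hc : Summable fun j => charlierSq ν j * c j ^ 2) :
    ∃ r : ℕ → ℝ, HasSum (fun k => r k ^ 2 / pois ν k) (∑' j, charlierSq ν j * c j ^ 2) ∧
      ∀ z, Summable (fun j => c j * (z - 1) ^ j) ∧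
        HasSum (fun k => r k * z ^ k) (Real.exp (ν * (z - 1)) * ∑' j, c j * (z - 1) ^ j) := by
  have ha : Summable fun j => (√(charlierSq ν j) * c j) ^ 2 :=
    hc.congr fun j => by rw [mul_pow, Real.sq_sqrt (charlierSq_pos hν j).le]
  set a := l2Of _ ha with ha'
  refine ⟨fun k => √(pois ν k) * charlierIso hν a k, ?_, fun z => ?_⟩
  · refine hasSum_of_forall_eq (hasSum_sq_norm (charlierIso hν a)) (fun k => ?_) ?_
    · have := pois_pos hν k
      rw [mul_pow, Real.sq_sqrt this.le]
      field_simp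
    · rw [LinearIsometry.norm_map, ← (hasSum_sq_norm a).tsum_eq]
      congr 1; ext j
      rw [ha', l2Of_apply, mul_pow, Real.sq_sqrt (charlierSq_pos hν j).le]
  · have h := hasSum_inner_charlierIso hν a (powVec hν z)
    have h1 : HasSum (fun j => c j * (z - 1) ^ j)
        (Real.exp (-(ν * (z - 1))) * inner ℝ (charlierIso hν a) (powVec hν z)) := by
      refine hasSum_of_forall_eq (h.mul_left _) (fun j => ?_) rfl
      have h1 := Real.sqrt_pos.2 (charlierSq_pos hν j)
      rw [inner_charlierVec_powVec, ha', l2Of_apply, powCoeff, Real.exp_neg]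
      have := Real.exp_pos (ν * (z - 1))
      field_simp
    refine ⟨h1.summable, hasSum_of_forall_eq (hasSum_mul_inner (charlierIso hν a) (powVec hν z))
      (fun k => ?_) ?_⟩
    · rw [powVec_apply]; ring
    · rw [h1.tsum_eq, ← mul_assoc, ← Real.exp_add]
      simp

/-! ### Differential inequalities -/

theorem antitoneOn_Ici_of_hasDerivWithinAt {f f' : ℝ → ℝ}
    (hf : ∀ t, 0 ≤ t → HasDerivWithinAt f (f' t) (Set.Ici 0) t) (h : ∀ t, 0 ≤ t → f' t ≤ 0) :
    AntitoneOn f (Set.Ici 0) :=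
  antitoneOn_of_hasDerivWithinAt_nonpos (convex_Ici 0)
    (fun t ht => (hf t ht).continuousWithinAt)
    (fun t ht => (hf t (interior_subset ht)).mono interior_subset)
    (fun t ht => h t (interior_subset ht))

theorem hasDerivWithinAt_exp_mul (a t : ℝ) (s : Set ℝ) :
    HasDerivWithinAt (fun t => Real.exp (a * t)) (a * Real.exp (a * t)) s t := by
  have h := ((hasDerivAt_id t).const_mul a).exp
  simp only [mul_one, id_eq] at h
  rw [mul_comm a (Real.exp _)]
  exact h.hasDerivWithinAt

/-- A solution of the logistic equation `x' = -(ν + x) x` decays exponentially. -/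
theorem le_exp_of_logistic {x : ℝ → ℝ} (hx1 : x 0 ≤ 1)
    (hx : ∀ t, 0 ≤ t → HasDerivWithinAt x (-((ν + x t) * x t)) (Set.Ici 0) t)
    {t : ℝ} (ht : 0 ≤ t) : x t ≤ Real.exp (-ν * t) := by
  -- The function e^{νt} x has derivative -x² e^{νt} ≤ 0.
  have h := antitoneOn_Ici_of_hasDerivWithinAt
    (fun t ht => (hx t ht).mul (hasDerivWithinAt_exp_mul ν t _)) (fun t ht => by
      have := mul_nonneg (sq_nonneg (x t)) (Real.exp_pos (ν * t)).le
      nlinarith)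
  have h1 := h (Set.mem_Ici.2 le_rfl) (Set.mem_Ici.2 ht) ht
  simp only [Pi.mul_apply, mul_zero, Real.exp_zero, mul_one] at h1
  rw [neg_mul, Real.exp_neg, ← one_div, le_div_iff₀ (Real.exp_pos _)]
  exact h1.trans hx1

/-- A perturbed Grönwall inequality. -/
theorem le_exp_of_deriv_le {S S' x : ℝ → ℝ} {K L : ℝ} (hν : 0 < ν) (hK : 0 ≤ K) (hL : 0 ≤ L)
    (hx0 : ∀ t, 0 ≤ t → 0 ≤ x t) (hx : ∀ t, 0 ≤ t → x t ≤ Real.exp (-ν * t))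
    (hS0 : ∀ t, 0 ≤ t → 0 ≤ S t)
    (hS : ∀ t, 0 ≤ t → HasDerivWithinAt S (S' t) (Set.Ici 0) t)
    (hS' : ∀ t, 0 ≤ t → S' t ≤ (-2 + K * x t) * S t + L * x t ^ 2) {t : ℝ} (ht : 0 ≤ t) :
    S t ≤ (S 0 + L / ν) * Real.exp (K / ν) * Real.exp (-(min ν 2 * t)) := by
  set m := min ν 2 with hm
  -- A decreasing Lyapunov function: the factor exp((K/ν) e^{-νt}) absorbs the perturbation K x S,
  -- and the added multiple of e^{-νt} absorbs the source L x².
  have hd : ∀ t, 0 ≤ t → HasDerivWithinAt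
      (fun t => S t * Real.exp (m * t) * Real.exp (K / ν * Real.exp (-ν * t))
        + L / ν * Real.exp (K / ν) * Real.exp (-ν * t))
      ((S' t * Real.exp (m * t) + S t * (m * Real.exp (m * t)))
          * Real.exp (K / ν * Real.exp (-ν * t))
        + S t * Real.exp (m * t) * (Real.exp (K / ν * Real.exp (-ν * t))
          * (K / ν * (-ν * Real.exp (-ν * t))))
        + L / ν * Real.exp (K / ν) * (-ν * Real.exp (-ν * t))) (Set.Ici 0) t := fun t ht =>
    (((hS t ht).mul (hasDerivWithinAt_exp_mul m t _)).mul
      ((hasDerivWithinAt_exp_mul (-ν) t _).const_mul (K / ν)).exp).add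
      ((hasDerivWithinAt_exp_mul (-ν) t _).const_mul _)
  have hanti := antitoneOn_Ici_of_hasDerivWithinAt hd (fun t ht => by
    set y := Real.exp (-ν * t) with hy
    set E := Real.exp (K / ν * y) with hE
    set F := Real.exp (m * t) with hF
    have hy0 : 0 < y := Real.exp_pos _
    have hE0 : 0 < E := Real.exp_pos _
    have hF0 : 0 < F := Real.exp_pos _
    have hy1 : y ≤ 1 := by
      rw [hy, Real.exp_le_one_iff]; nlinarith
    have hE1 : E ≤ Real.exp (K / ν) := by
      rw [hE]; apply Real.exp_le_exp.2
      exact mul_le_of_le_one_right (by positivity) hy1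
    have hFy : F * y ≤ 1 := by
      rw [hF, hy, ← Real.exp_add, Real.exp_le_one_iff]
      nlinarith [min_le_left ν 2]
    -- One factor e^{-νt} of x² offsets the weight e^{mt}, as m ≤ ν; the other remains and is
    -- integrable. This also covers m = ν without polynomial loss.
    have hx2 : F * x t ^ 2 ≤ y := by
      have h1 : x t ^ 2 ≤ y ^ 2 := pow_le_pow_left₀ (hx0 t ht) (hx t ht) 2
      calc F * x t ^ 2 ≤ F * y ^ 2 := by gcongr
        _ = (F * y) * y := by ring
        _ ≤ 1 * y := by gcongr
        _ = y := one_mul y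
    have h1 : S' t + m * S t - K * y * S t ≤ L * x t ^ 2 := by
      have h2 := hS' t ht
      have h3 : m * S t ≤ 2 * S t := mul_le_mul_of_nonneg_right (min_le_right _ _) (hS0 t ht)
      have h4 : K * x t * S t ≤ K * y * S t :=
        mul_le_mul_of_nonneg_right (mul_le_mul_of_nonneg_left (hx t ht) hK) (hS0 t ht)
      linarith
    have h2 : F * E * (S' t + m * S t - K * y * S t) ≤ L * Real.exp (K / ν) * y := by
      calc _ ≤ F * E * (L * x t ^ 2) := by gcongr
        _ = L * E * (F * x t ^ 2) := by ring
        _ ≤ L * Real.exp (K / ν) * y := by gcongr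
    refine le_trans (le_of_eq ?_) (sub_nonpos.2 h2)
    field_simp
    ring)
  have h1 := hanti (Set.mem_Ici.2 le_rfl) (Set.mem_Ici.2 ht) ht
  simp only [mul_zero, Real.exp_zero, mul_one] at h1
  have h2 : S t * Real.exp (m * t) ≤ S t * Real.exp (m * t) * Real.exp (K / ν * Real.exp (-ν * t)) :=
    le_mul_of_one_le_right (mul_nonneg (hS0 t ht) (Real.exp_pos _).le)
      (Real.one_le_exp (by positivity))
  have h3 : 0 ≤ L / ν * Real.exp (K / ν) * Real.exp (-ν * t) := by positivity
  rw [Real.exp_neg, ← div_eq_mul_inv, le_div_iff₀ (Real.exp_pos _)]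
  linarith

/-! ### The coefficient hierarchy and its energy -/

/-- The solution of `y' = -a y + g` on `[0, ∞)` with `y(0) = b`. -/
def linearSol (a b : ℝ) (g : ℝ → ℝ) (t : ℝ) : ℝ :=
  Real.exp (-a * t) * (b + ∫ s in (0 : ℝ)..t, Real.exp (a * s) * g (max s 0))

theorem linearSol_zero (a b : ℝ) (g : ℝ → ℝ) : linearSol a b g 0 = b := by
  simp [linearSol]

theorem hasDerivWithinAt_linearSol (a b : ℝ) {g : ℝ → ℝ} (hg : ContinuousOn g (Set.Ici 0))
    {t : ℝ} (ht : 0 ≤ t) :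
    HasDerivWithinAt (linearSol a b g) (-a * linearSol a b g t + g t) (Set.Ici 0) t := by
  -- Freezing g at its value at 0 for negative times makes the integrand continuous on all of ℝ.
  have hc : Continuous fun s : ℝ => Real.exp (a * s) * g (max s 0) :=
    (by fun_prop : Continuous fun s : ℝ => Real.exp (a * s)).mul
      (hg.comp_continuous (by fun_prop) fun s => le_max_right s 0)
  have h := (hasDerivWithinAt_exp_mul (-a) t (Set.Ici 0)).mul
    (((hc.integral_hasStrictDerivAt 0 t).hasDerivAt.const_add b).hasDerivWithinAt
      (s := Set.Ici 0))
  refine h.congr_deriv ?_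
  have e : Real.exp (-a * t) * Real.exp (a * t) = 1 := by
    rw [← Real.exp_add]; simp
  simp only [linearSol, max_eq_left ht]
  linear_combination g t * e

/-- The Charlier coefficients along a solution whose component of index `0` is `x`. -/
def coeffCurve (ν : ℝ) (x : ℝ → ℝ) (c : ℕ → ℝ) : ℕ → ℝ → ℝ
  | 0 => fun t => 1 - x t
  | 1 => fun t => (ν + 1) * x t
  | j + 2 => linearSol ((j : ℝ) + 2) (c (j + 2)) fun t =>
      x t * coeffCurve ν x c (j + 1) t
        + (ν + x t) * x t * ((-ν) ^ (j + 2) / ((j + 2).factorial : ℝ))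

theorem hasDerivWithinAt_coeffCurve {x : ℝ → ℝ}
    (hx : ∀ t, 0 ≤ t → HasDerivWithinAt x (-((ν + x t) * x t)) (Set.Ici 0) t)
    (c : ℕ → ℝ) (j : ℕ) {t : ℝ} (ht : 0 ≤ t) :
    HasDerivWithinAt (coeffCurve ν x c (j + 1))
      (-((j : ℝ) + 1) * coeffCurve ν x c (j + 1) t + x t * coeffCurve ν x c j t
        + (ν + x t) * x t * ((-ν) ^ (j + 1) / ((j + 1).factorial : ℝ))) (Set.Ici 0) t := by
  induction j generalizing t with
  | zero =>
    -- The prescribed degree-one curve fits the hierarchy because x is logistic: both sides equal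
    -- -(ν+1)(ν+x)x.
    refine ((hx t ht).const_mul (ν + 1)).congr_deriv ?_
    simp [coeffCurve]
    ring
  | succ j ih =>
    have hcx : ContinuousOn x (Set.Ici 0) := fun t ht => (hx t ht).continuousWithinAt
    have hcc : ContinuousOn (coeffCurve ν x c (j + 1)) (Set.Ici 0) :=
      fun t ht => (ih ht).continuousWithinAt
    have h := hasDerivWithinAt_linearSol ((j : ℝ) + 2) (c (j + 2))
      (g := fun t => x t * coeffCurve ν x c (j + 1) t
        + (ν + x t) * x t * ((-ν) ^ (j + 2) / ((j + 2).factorial : ℝ)))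
      (by fun_prop) ht
    refine h.congr_deriv ?_
    rw [coeffCurve]
    push_cast
    ring

/-- The truncated energy of a sequence of coefficients. -/
def energy (ν : ℝ) (J : ℕ) (c : ℕ → ℝ) : ℝ :=
  ∑ j ∈ Finset.range J, charlierSq ν (j + 2) * c (j + 2) ^ 2

theorem energy_nonneg (hν : 0 < ν) (J : ℕ) (c : ℕ → ℝ) : 0 ≤ energy ν J c :=
  Finset.sum_nonneg fun j _ => mul_nonneg (charlierSq_pos hν _).le (sq_nonneg _)

theorem charlierSq_mul_pow_div (hν : 0 < ν) (j : ℕ) :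
    charlierSq ν j * ((-ν) ^ j / (j.factorial : ℝ)) = (-1) ^ j := by
  unfold charlierSq
  rw [neg_pow]
  field_simp

/-- Two completed squares split the damping -2(j+2): the coupling to degree j+1 uses x(j+2) and the
source uses 2. What remains is at most -2 + 2x, since j(2-x) ≥ 0. -/
theorem energy_term_le (hν : 0 < ν) {x : ℝ} (hx0 : 0 ≤ x) (hx1 : x ≤ 1) (a b : ℝ) (j : ℕ) :
    charlierSq ν (j + 2) * (2 * a * (-((j : ℝ) + 2) * a + x * b
        + (ν + x) * x * ((-ν) ^ (j + 2) / ((j + 2).factorial : ℝ))))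
      ≤ (-2 + 2 * x) * (charlierSq ν (j + 2) * a ^ 2)
        + x / ν * (charlierSq ν (j + 1) * b ^ 2)
        + (ν + 1) ^ 2 * x ^ 2 / 2 * (charlierSq ν (j + 2))⁻¹ := by
  have hW := charlierSq_pos hν (j + 2)
  have hW1 : charlierSq ν (j + 2) = ((j : ℝ) + 2) / ν * charlierSq ν (j + 1) := by
    rw [charlierSq_succ hν]; push_cast; ring
  have hV := charlierSq_pos hν (j + 1)
  have hσ := charlierSq_mul_pow_div hν (j + 2)
  have hσ2 : ((-1 : ℝ) ^ (j + 2)) ^ 2 = 1 := by rw [← pow_mul, mul_comm, pow_mul]; simp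
  set σ := (-1 : ℝ) ^ (j + 2)
  set W := charlierSq ν (j + 2)
  set V := charlierSq ν (j + 1)
  set e := (-ν) ^ (j + 2) / ((j + 2).factorial : ℝ)
  have hj : (0 : ℝ) ≤ (j : ℝ) := by positivity
  have h1 : W * (2 * a * (x * b)) ≤ x * ((j : ℝ) + 2) * (W * a ^ 2) + x / ν * (V * b ^ 2) := by
    have h : 0 ≤ x * (V / ν) * (((j : ℝ) + 2) * a - b) ^ 2 := by positivity
    have e1 : x * ((j : ℝ) + 2) * (W * a ^ 2) + x / ν * (V * b ^ 2) - W * (2 * a * (x * b))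
        = x * (V / ν) * (((j : ℝ) + 2) * a - b) ^ 2 := by
      rw [hW1]; ring
    linarith
  have h2 : W * (2 * a * ((ν + x) * x * e))
      ≤ 2 * (W * a ^ 2) + (ν + x) ^ 2 * x ^ 2 / 2 * W⁻¹ := by
    have h : 0 ≤ 2 * W * (a - (ν + x) * x * σ / (2 * W)) ^ 2 := by positivity
    have e1 : 2 * W * (a - (ν + x) * x * σ / (2 * W)) ^ 2
        = 2 * (W * a ^ 2) - 2 * a * ((ν + x) * x) * σ
          + (ν + x) ^ 2 * x ^ 2 / 2 * W⁻¹ * σ ^ 2 := by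
      field_simp
      ring
    rw [e1, hσ2, ← hσ] at h
    linarith
  have h3 : (ν + x) ^ 2 * x ^ 2 / 2 * W⁻¹ ≤ (ν + 1) ^ 2 * x ^ 2 / 2 * W⁻¹ := by gcongr
  have h4 : 0 ≤ (j : ℝ) * (2 - x) * (W * a ^ 2) := by
    have : 0 ≤ 2 - x := by linarith
    positivity
  nlinarith

theorem sum_inv_charlierSq_le (hν : 0 < ν) (J : ℕ) :
    ∑ j ∈ Finset.range J, (charlierSq ν (j + 2))⁻¹ ≤ Real.exp ν := by
  have h := Real.sum_le_exp_of_nonneg hν.le (J + 2)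
  rw [Finset.sum_range_succ', Finset.sum_range_succ'] at h
  refine le_trans ?_ h
  simp only [charlierSq, inv_div]
  have : (0 : ℝ) ≤ ν ^ (0 + 1) / ((0 + 1).factorial : ℝ) + ν ^ 0 / (Nat.factorial 0 : ℝ) := by
    positivity
  linarith

/-- The finite sum can be differentiated termwise, and the constants do not depend on J. Omitting
degrees 0 and 1 leaves damping to spare, while their effect enters only through x. -/
theorem energy_coeffCurve_le (hν : 0 < ν) {x : ℝ → ℝ}
    (hx0 : ∀ t, 0 ≤ t → 0 ≤ x t) (hx1 : ∀ t, 0 ≤ t → x t ≤ 1)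
    (hx : ∀ t, 0 ≤ t → HasDerivWithinAt x (-((ν + x t) * x t)) (Set.Ici 0) t)
    (c : ℕ → ℝ) (J : ℕ) {t : ℝ} (ht : 0 ≤ t) :
    energy ν J (fun j => coeffCurve ν x c j t)
      ≤ (energy ν J c + ((ν + 1) ^ 2 / ν ^ 2 + (ν + 1) ^ 2 / 2 * Real.exp ν) / ν)
        * Real.exp ((2 + 1 / ν) / ν) * Real.exp (-(min ν 2 * t)) := by
  have h0 : energy ν J c = energy ν J (fun j => coeffCurve ν x c j 0) := by
    simp [energy, coeffCurve, linearSol_zero]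
  rw [h0]
  refine le_exp_of_deriv_le (S := fun t => energy ν J (fun j => coeffCurve ν x c j t)) hν
    (by positivity) (by positivity) hx0
    (fun t ht => le_exp_of_logistic (hx1 0 le_rfl) hx ht)
    (fun t _ => energy_nonneg hν J _)
    (fun t ht => HasDerivWithinAt.fun_sum fun j _ =>
      ((hasDerivWithinAt_coeffCurve hx c (j + 1) ht).fun_pow 2).const_mul _)
    (fun t ht => ?_) ht
  set d := fun j => coeffCurve ν x c j t with hd
  have hxt := hx0 t ht
  -- Coupling involves degrees 1 to J: degree one is explicit in x, and the rest is part of the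
  -- energy, which runs over degrees 2 to J+1.
  have h1 : ∑ j ∈ Finset.range J, charlierSq ν (j + 1) * d (j + 1) ^ 2
      ≤ (ν + 1) ^ 2 / ν * x t ^ 2 + energy ν J d := by
    have e := Finset.sum_range_succ' (fun j => charlierSq ν (j + 1) * d (j + 1) ^ 2) J
    rw [Finset.sum_range_succ] at e
    have e1 : charlierSq ν (0 + 1) * d (0 + 1) ^ 2 = (ν + 1) ^ 2 / ν * x t ^ 2 := by
      simp [charlierSq, hd, coeffCurve]; ring
    have e2 : 0 ≤ charlierSq ν (J + 1) * d (J + 1) ^ 2 :=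
      mul_nonneg (charlierSq_pos hν _).le (sq_nonneg _)
    rw [e1] at e
    unfold energy
    linarith
  have h2 := sum_inv_charlierSq_le hν J
  calc _ ≤ ∑ j ∈ Finset.range J, ((-2 + 2 * x t) * (charlierSq ν (j + 2) * d (j + 2) ^ 2)
        + x t / ν * (charlierSq ν (j + 1) * d (j + 1) ^ 2)
        + (ν + 1) ^ 2 * x t ^ 2 / 2 * (charlierSq ν (j + 2))⁻¹) := by
        refine Finset.sum_le_sum fun j _ => ?_
        refine le_trans (le_of_eq ?_)
          (energy_term_le hν hxt (hx1 t ht) (d (j + 2)) (d (j + 1)) j)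
        simp only [hd]
        push_cast
        ring
    _ = (-2 + 2 * x t) * energy ν J d
        + x t / ν * ∑ j ∈ Finset.range J, charlierSq ν (j + 1) * d (j + 1) ^ 2
        + (ν + 1) ^ 2 * x t ^ 2 / 2 * ∑ j ∈ Finset.range J, (charlierSq ν (j + 2))⁻¹ := by
        rw [Finset.sum_add_distrib, Finset.sum_add_distrib, ← Finset.mul_sum, ← Finset.mul_sum,
          ← Finset.mul_sum, energy]
    _ ≤ (-2 + 2 * x t) * energy ν J d
        + x t / ν * ((ν + 1) ^ 2 / ν * x t ^ 2 + energy ν J d)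
        + (ν + 1) ^ 2 * x t ^ 2 / 2 * Real.exp ν := by gcongr
    _ = (-2 + (2 + 1 / ν) * x t) * energy ν J d + (ν + 1) ^ 2 / ν ^ 2 * x t ^ 2 * x t
        + (ν + 1) ^ 2 * x t ^ 2 / 2 * Real.exp ν := by field_simp; ring
    _ ≤ (-2 + (2 + 1 / ν) * x t) * energy ν J d + (ν + 1) ^ 2 / ν ^ 2 * x t ^ 2 * 1
        + (ν + 1) ^ 2 * x t ^ 2 / 2 * Real.exp ν := by
        have := hx1 t ht
        gcongr
    _ = _ := by ring

/-! ### Truncation limits, uniqueness of power series, initial moments -/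

theorem abs_exp_sub_sum_le {a A : ℝ} (h : |a| ≤ A) (N : ℕ) :
    |Real.exp a - ∑ j ∈ Finset.range N, a ^ j / (j.factorial : ℝ)|
      ≤ Real.exp A - ∑ j ∈ Finset.range N, A ^ j / (j.factorial : ℝ) := by
  have hs : ∀ a : ℝ, HasSum (fun j : ℕ => a ^ (j + N) / ((j + N).factorial : ℝ))
      (Real.exp a - ∑ j ∈ Finset.range N, a ^ j / (j.factorial : ℝ)) := fun a => by
    have h := NormedSpace.expSeries_div_hasSum_exp (𝔸 := ℝ) a
    rw [← Real.exp_eq_exp_ℝ] at h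
    exact (hasSum_nat_add_iff' (f := fun j : ℕ => a ^ j / (j.factorial : ℝ)) N).2 h
  refine (hs a).norm_le_of_bounded (hs A) fun j => ?_
  rw [Real.norm_eq_abs, abs_div, abs_pow, Nat.abs_cast]
  gcongr

theorem tendsto_exp_sub_sum (A : ℝ) :
    Tendsto (fun N => Real.exp A - ∑ j ∈ Finset.range (N + 1), A ^ j / (j.factorial : ℝ))
      atTop (𝓝 0) := by
  have h := NormedSpace.expSeries_div_hasSum_exp (𝔸 := ℝ) A
  rw [← Real.exp_eq_exp_ℝ] at h
  have h1 := (h.tendsto_sum_nat.comp (tendsto_add_atTop_nat 1)).const_sub (Real.exp A)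
  rwa [sub_self] at h1

/-- Solutions of perturbed linear equations with vanishing data and perturbations vanish. -/
theorem tendsto_zero_of_abs_deriv_le {D D' : ℕ → ℝ → ℝ} {η : ℕ → ℝ} {K T : ℝ} (hK : K ≠ 0)
    (hT : 0 ≤ T) (hD : ∀ N t, 0 ≤ t → HasDerivWithinAt (D N) (D' N t) (Set.Ici 0) t)
    (hb : ∀ᶠ N in atTop, ∀ t, 0 ≤ t → t ≤ T → |D' N t| ≤ K * |D N t| + η N)
    (h0 : Tendsto (fun N => D N 0) atTop (𝓝 0)) (hη : Tendsto η atTop (𝓝 0)) :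
    Tendsto (fun N => D N T) atTop (𝓝 0) := by
  have hlim : Tendsto (fun N => |D N 0| * Real.exp (K * (T - 0))
      + η N / K * (Real.exp (K * (T - 0)) - 1)) atTop (𝓝 0) := by
    have h := (h0.abs.mul_const (Real.exp (K * (T - 0)))).add
      ((hη.div_const K).mul_const (Real.exp (K * (T - 0)) - 1))
    simpa using h
  refine squeeze_zero_norm' ?_ hlim
  filter_upwards [hb] with N hN
  have h := norm_le_gronwallBound_of_norm_deriv_right_le
    (fun t ht => (hD N t ht.1).continuousWithinAt.mono Set.Icc_subset_Ici_self)
    (fun t ht => (hD N t ht.1).mono (Set.Ici_subset_Ici.2 ht.1)) le_rfl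
    (fun t ht => hN t ht.1 ht.2.le) T ⟨hT, le_rfl⟩
  rw [gronwallBound_of_K_ne_0 hK] at h
  exact h

theorem eq_of_hasSum_pow {a b : ℕ → ℝ} {f : ℝ → ℝ}
    (ha : ∀ z, |z| < 1 → HasSum (fun k => a k * z ^ k) (f z))
    (hb : ∀ z, |z| < 1 → HasSum (fun k => b k * z ^ k) (f z)) : a = b := by
  have key : ∀ c : ℕ → ℝ, (∀ z, |z| < 1 → HasSum (fun k => c k * z ^ k) (f z)) →
      HasFPowerSeriesAt f (FormalMultilinearSeries.ofScalars ℝ c) 0 := by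
    intro c hc
    rw [hasFPowerSeriesAt_iff]
    filter_upwards [Metric.ball_mem_nhds (0 : ℝ) one_pos] with z hz
    rw [mem_ball_zero_iff, Real.norm_eq_abs] at hz
    rw [zero_add]
    exact hasSum_of_forall_eq (hc z hz)
      (fun k => by simp [FormalMultilinearSeries.coeff_ofScalars, mul_comm]) rfl
  have h := (key a ha).eq_formalMultilinearSeries (key b hb)
  ext k
  have h1 := congrArg (fun s => FormalMultilinearSeries.coeff s k) h
  simpa [FormalMultilinearSeries.coeff_ofScalars] using h1

theorem IsProb.le_one {p : ℕ → ℝ} (h : IsProb p) (n : ℕ) : p n ≤ 1 :=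
  le_hasSum h.2 n fun k _ => h.1 k

theorem IsProb.hasSum_succ {p : ℕ → ℝ} (h : IsProb p) :
    HasSum (fun k => p (k + 1)) (1 - p 0) := by
  simpa using (hasSum_nat_add_iff' 1).2 h.2

theorem IsProb.summable_mul_pow {p : ℕ → ℝ} (h : IsProb p) {z : ℝ} (hz : |z| ≤ 1) :
    Summable fun k => p (k + 1) * z ^ k := by
  refine Summable.of_norm_bounded h.hasSum_succ.summable fun k => ?_
  rw [norm_mul, norm_pow, Real.norm_eq_abs, Real.norm_eq_abs, abs_of_nonneg (h.1 _)]
  exact mul_le_of_le_one_right (h.1 _) (pow_le_one₀ (abs_nonneg z) hz)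

theorem charlierCoeff_zero {p : ℕ → ℝ} (h : IsProb p) :
    charlierCoeff ν (fun k => p (k + 1)) 0 = 1 - p 0 := by
  simp [charlierCoeff, charlier, charlierSq, h.hasSum_succ.tsum_eq]

/-- As C_1(k) = k/ν - 1, this is where the mean of the initial data enters. -/
theorem charlierCoeff_one (hν : 0 < ν) {p : ℕ → ℝ} (h : p ∈ probWithMean (ν + 1)) :
    charlierCoeff ν (fun k => p (k + 1)) 1 = (ν + 1) * p 0 := by
  obtain ⟨h1, h2⟩ := h
  have h3 : HasSum (fun k : ℕ => ((k : ℝ) + 1) * p (k + 1)) (ν + 1) := by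
    have := (hasSum_nat_add_iff' 1).2 h2
    simpa using this
  have h4 : HasSum (fun k : ℕ => p (k + 1) * charlier ν 1 k) ((ν + 1) * p 0 / ν) := by
    refine hasSum_of_forall_eq ((h3.sub (h1.hasSum_succ.mul_right (ν + 1))).mul_right ν⁻¹)
      (fun k => ?_) ?_
    · simp only [charlier]
      field_simp
      ring
    · field_simp
      ring
  rw [charlierCoeff, h4.tsum_eq]
  simp [charlierSq]
  field_simp

section Solution

variable {p : ℝ → ℕ → ℝ}

theorem IsSolution.hasDeriv_zero (hp : IsSolution (ν + 1) p) {t : ℝ} (ht : 0 ≤ t) :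
    HasDerivWithinAt (fun s => p s 0) (-((ν + p t 0) * p t 0)) (Set.Ici 0) t := by
  refine (hp.hasDeriv t ht 0).congr_deriv ?_
  simp only [Qhat, Dminus, shift, Pi.sub_apply]
  ring

theorem IsSolution.hasDeriv_succ (hp : IsSolution (ν + 1) p) {t : ℝ} (ht : 0 ≤ t) (k : ℕ) :
    HasDerivWithinAt (fun s => p s (k + 1))
      (((k : ℝ) + 1) * p t (k + 2) - k * p t (k + 1)
        + (ν + p t 0) * (p t k - p t (k + 1))) (Set.Ici 0) t := by
  refine (hp.hasDeriv t ht (k + 1)).congr_deriv ?_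
  simp only [Qhat, Dminus, shift, Pi.sub_apply]
  ring

/-- The truncated generating function along a characteristic `z = 1 + w`, `w' = w`. -/
theorem IsSolution.hasDeriv_genSum (hp : IsSolution (ν + 1) p) {w : ℝ → ℝ} {t : ℝ} (ht : 0 ≤ t)
    (hw : HasDerivWithinAt w (w t) (Set.Ici 0) t) (N : ℕ) :
    HasDerivWithinAt (fun s => ∑ k ∈ Finset.range N, p s (k + 1) * (1 + w s) ^ k)
      ((ν + p t 0) * w t * ∑ k ∈ Finset.range N, p t (k + 1) * (1 + w t) ^ k
        + (ν + p t 0) * p t 0 + N * p t (N + 1) * (1 + w t) ^ (N - 1)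
        - (ν + p t 0) * p t N * (1 + w t) ^ N) (Set.Ici 0) t := by
  induction N with
  | zero =>
    simp only [Finset.range_zero, Finset.sum_empty]
    refine (hasDerivWithinAt_const t (Set.Ici 0) (0 : ℝ)).congr_deriv ?_
    simp
  | succ N ih =>
    simp only [Finset.sum_range_succ]
    refine (ih.add ((hp.hasDeriv_succ ht N).mul ((hw.const_add 1).fun_pow N))).congr_deriv ?_
    -- At N = 0 the truncated exponent is harmless because of the factor N.
    have hN : (N : ℝ) * (1 + w t) ^ (N - 1) * (1 + w t) = N * (1 + w t) ^ N := by
      rcases N with _ | N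
      · simp
      · rw [Nat.add_sub_cancel]; ring
    rw [Nat.add_sub_cancel]
    push_cast
    linear_combination (p t (N + 1)) * hN

/-- The truncated Charlier expansion along a characteristic. -/
theorem hasDeriv_coeffSum {x : ℝ → ℝ}
    (hx : ∀ t, 0 ≤ t → HasDerivWithinAt x (-((ν + x t) * x t)) (Set.Ici 0) t)
    (c : ℕ → ℝ) {w : ℝ → ℝ} {t : ℝ} (ht : 0 ≤ t)
    (hw : HasDerivWithinAt w (w t) (Set.Ici 0) t) (N : ℕ) :
    HasDerivWithinAt (fun s => ∑ j ∈ Finset.range (N + 1), coeffCurve ν x c j s * w s ^ j)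
      (x t * w t * ∑ j ∈ Finset.range (N + 1), coeffCurve ν x c j t * w t ^ j
        - x t * coeffCurve ν x c N t * w t ^ (N + 1)
        + (ν + x t) * x t * ∑ j ∈ Finset.range (N + 1),
          (-(ν * w t)) ^ j / (j.factorial : ℝ)) (Set.Ici 0) t := by
  induction N with
  | zero =>
    simp only [zero_add, Finset.sum_range_one, pow_zero, mul_one, coeffCurve]
    refine ((hx t ht).const_sub 1).congr_deriv ?_
    simp
    ring
  | succ N ih =>
    rw [Finset.sum_range_succ _ (N + 1), Finset.sum_range_succ _ (N + 1)]
    simp only [Finset.sum_range_succ _ (N + 1)]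
    refine (ih.add ((hasDerivWithinAt_coeffCurve hx c N ht).mul (hw.fun_pow (N + 1)))).congr_deriv ?_
    rw [Nat.add_sub_cancel, show -(ν * w t) = (-ν) * w t by ring, mul_pow _ _ (N + 1)]
    push_cast
    ring

end Solution

/-! ### Identification of the solution with its coefficients -/

/-- The constant in the decay of the energy of the coefficients. -/
def energyConst (ν B : ℝ) : ℝ :=
  (B + ((ν + 1) ^ 2 / ν ^ 2 + (ν + 1) ^ 2 / 2 * Real.exp ν) / ν) * Real.exp ((2 + 1 / ν) / ν)

variable {p : ℝ → ℕ → ℝ}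

/-- The Charlier coefficients of `(pₖ₊₁(t))ₖ` for a solution `p`. -/
def solCoeff (ν : ℝ) (p : ℝ → ℕ → ℝ) : ℕ → ℝ → ℝ :=
  coeffCurve ν (fun s => p s 0) (charlierCoeff ν fun k => p 0 (k + 1))

theorem IsSolution.energy_solCoeff_le (hν : 0 < ν) (hp : IsSolution (ν + 1) p)
    (hq : Summable fun k => p 0 (k + 1) ^ 2 / pois ν k) (J : ℕ) {t : ℝ} (ht : 0 ≤ t) :
    energy ν J (fun j => solCoeff ν p j t)
      ≤ energyConst ν (∑' k, p 0 (k + 1) ^ 2 / pois ν k) * Real.exp (-(min ν 2 * t)) := by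
  refine (energy_coeffCurve_le hν (fun t ht => (hp.isProb t ht).1 0)
    (fun t ht => (hp.isProb t ht).le_one 0) (fun t ht => hp.hasDeriv_zero ht) _ J ht).trans ?_
  unfold energyConst
  gcongr
  -- Bessel over the degrees 2 to J+1.
  have h := sum_charlierSq_mul_coeff_sq_le hν hq
    ((Finset.range J).map ⟨fun j => j + 2, add_left_injective 2⟩)
  rw [Finset.sum_map] at h
  exact h

theorem solCoeff_zero (hν : 0 < ν) (hp : IsSolution (ν + 1) p)
    (hm : p 0 ∈ probWithMean (ν + 1)) (j : ℕ) :
    solCoeff ν p j 0 = charlierCoeff ν (fun k => p 0 (k + 1)) j := by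
  rcases j with _ | _ | j
  · rw [charlierCoeff_zero (hp.isProb 0 le_rfl)]; rfl
  · rw [zero_add, charlierCoeff_one hν hm]; rfl
  · simp [solCoeff, coeffCurve, linearSol_zero]

/-- A single term of the bounded energy gives |c_N| ≲ (ν^N/N!)^{1/2}, enough to beat |w|^{N+1} ≤
2^{N+1} uniformly in time. -/
theorem IsSolution.abs_solCoeff_le (hν : 0 < ν) (hp : IsSolution (ν + 1) p)
    (hq : Summable fun k => p 0 (k + 1) ^ 2 / pois ν k) {N : ℕ} (hN : 2 ≤ N) {t : ℝ}
    (ht : 0 ≤ t) :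
    |solCoeff ν p N t| * 2 ^ (N + 1)
      ≤ √(4 * energyConst ν (∑' k, p 0 (k + 1) ^ 2 / pois ν k)
        * ((4 * ν) ^ N / (N.factorial : ℝ))) := by
  obtain ⟨M, rfl⟩ := Nat.exists_eq_add_of_le' hN
  set B := energyConst ν (∑' k, p 0 (k + 1) ^ 2 / pois ν k)
  apply Real.le_sqrt_of_sq_le
  have h := hp.energy_solCoeff_le hν hq (M + 1) ht
  have h0 : 0 ≤ energy ν M (fun j => solCoeff ν p j t) := energy_nonneg hν M _
  rw [energy, Finset.sum_range_succ] at h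
  rw [energy] at h0
  have hB : charlierSq ν (M + 2) * solCoeff ν p (M + 2) t ^ 2 ≤ B := by
    have hB0 : 0 ≤ B * Real.exp (-(min ν 2 * t)) := by
      have h1 := mul_nonneg (charlierSq_pos hν (M + 2)).le (sq_nonneg (solCoeff ν p (M + 2) t))
      linarith
    have hB1 : 0 ≤ B := nonneg_of_mul_nonneg_left hB0 (Real.exp_pos _)
    have h2 : Real.exp (-(min ν 2 * t)) ≤ 1 := by
      rw [Real.exp_le_one_iff]
      have : 0 ≤ min ν 2 := le_min hν.le (by norm_num)
      nlinarith [mul_nonneg this ht]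
    have h3 : B * Real.exp (-(min ν 2 * t)) ≤ B := mul_le_of_le_one_right hB1 h2
    linarith
  rw [charlierSq, div_mul_eq_mul_div, div_le_iff₀ (by positivity)] at hB
  rw [mul_pow, sq_abs, mul_div_assoc', le_div_iff₀ (by positivity)]
  calc _ = 4 * 4 ^ (M + 2) * (((M + 2).factorial : ℝ) * solCoeff ν p (M + 2) t ^ 2) := by
        rw [← pow_mul, mul_comm (M + 2 + 1) 2, pow_mul]; norm_num; ring
    _ ≤ 4 * 4 ^ (M + 2) * (B * ν ^ (M + 2)) := by gcongr
    _ = _ := by rw [mul_pow]; ring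

/-- With θ = e^{s-T}, the point (1-θ) + θz is a convex combination of 1 and z with θ ≥ e^{-T}, so
the characteristic stays in a disc of radius less than 1 up to time T. -/
theorem abs_charPoint_le {z s T : ℝ} (hz : |z| < 1) (hs0 : 0 ≤ s) (hs : s ≤ T) :
    |1 + (z - 1) * Real.exp (s - T)| ≤ 1 - Real.exp (-T) * (1 - |z|) ∧
      |(z - 1) * Real.exp (s - T)| ≤ 2 := by
  have h1 : Real.exp (s - T) ≤ 1 := by rw [Real.exp_le_one_iff]; linarith
  have h2 : Real.exp (-T) ≤ Real.exp (s - T) := Real.exp_le_exp.2 (by linarith)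
  have h3 := Real.exp_pos (s - T)
  set θ := Real.exp (s - T)
  constructor
  · calc |1 + (z - 1) * θ| = |(1 - θ) + θ * z| := by congr 1; ring
      _ ≤ |1 - θ| + |θ * z| := abs_add_le _ _
      _ = (1 - θ) + θ * |z| := by rw [abs_mul, abs_of_pos h3, abs_of_nonneg (by linarith)]
      _ ≤ _ := by nlinarith
  · rw [abs_mul, abs_of_pos h3]
    have : |z - 1| ≤ 2 := by rw [abs_lt] at hz; rw [abs_le]; constructor <;> linarith
    nlinarith [abs_nonneg (z - 1)]

/-- The difference between the truncated generating function and its truncated expansion. -/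
def genDiff (ν : ℝ) (p : ℝ → ℕ → ℝ) (w : ℝ → ℝ) (N : ℕ) (s : ℝ) : ℝ :=
  Real.exp (-(ν * w s)) * ∑ k ∈ Finset.range (N + 1), p s (k + 1) * (1 + w s) ^ k
    - ∑ j ∈ Finset.range (N + 1), solCoeff ν p j s * w s ^ j

/-- The truncation error in the equation for `genDiff`. -/
def genErr (ν : ℝ) (p : ℝ → ℕ → ℝ) (w : ℝ → ℝ) (N : ℕ) (s : ℝ) : ℝ :=
  Real.exp (-(ν * w s)) * (((N : ℝ) + 1) * p s (N + 2) * (1 + w s) ^ N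
      - (ν + p s 0) * p s (N + 1) * (1 + w s) ^ (N + 1))
    + p s 0 * (solCoeff ν p N s * w s ^ (N + 1))
    + (ν + p s 0) * p s 0 * (Real.exp (-(ν * w s))
      - ∑ j ∈ Finset.range (N + 1), (-(ν * w s)) ^ j / (j.factorial : ℝ))

theorem IsSolution.hasDeriv_genDiff (hp : IsSolution (ν + 1) p) {w : ℝ → ℝ} {t : ℝ} (ht : 0 ≤ t)
    (hw : HasDerivWithinAt w (w t) (Set.Ici 0) t) (N : ℕ) :
    HasDerivWithinAt (genDiff ν p w N)
      (p t 0 * w t * genDiff ν p w N t + genErr ν p w N t) (Set.Ici 0) t := by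
  refine (((hw.const_mul ν).fun_neg.exp.mul (hp.hasDeriv_genSum ht hw (N + 1))).sub
    (hasDeriv_coeffSum (fun t ht => hp.hasDeriv_zero ht) _ ht hw N)).congr_deriv ?_
  simp only [genDiff, genErr, solCoeff, Nat.add_sub_cancel]
  push_cast
  ring

/-- The three errors are the boundary terms of the generating sum, geometrically small because ρ < 1
in the application; the coefficient lost by truncating the coupling; and a tail of the exponential
series. -/
theorem IsSolution.abs_genErr_le (hν : 0 < ν) (hp : IsSolution (ν + 1) p)
    (hq : Summable fun k => p 0 (k + 1) ^ 2 / pois ν k) {w : ℝ → ℝ} {t ρ : ℝ} (ht : 0 ≤ t)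
    (hw : |w t| ≤ 2) (hρ : |1 + w t| ≤ ρ) {N : ℕ} (hN : 2 ≤ N) :
    |genErr ν p w N t| ≤ Real.exp (2 * ν) * (((N : ℝ) + 1) * ρ ^ N + (ν + 1) * ρ ^ (N + 1))
      + √(4 * energyConst ν (∑' k, p 0 (k + 1) ^ 2 / pois ν k)
        * ((4 * ν) ^ N / (N.factorial : ℝ)))
      + (ν + 1) * (Real.exp (2 * ν)
        - ∑ j ∈ Finset.range (N + 1), (2 * ν) ^ j / (j.factorial : ℝ)) := by
  have hP := hp.isProb t ht
  have ha : |-(ν * w t)| ≤ 2 * ν := by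
    rw [abs_neg, abs_mul, abs_of_pos hν]; nlinarith
  have hexp : Real.exp (-(ν * w t)) ≤ Real.exp (2 * ν) :=
    Real.exp_le_exp.2 ((le_abs_self _).trans ha)
  have hp1 : ∀ n, |p t n| ≤ 1 := fun n => by
    rw [abs_of_nonneg (hP.1 n)]; exact hP.le_one n
  have hl : |ν + p t 0| ≤ ν + 1 := by
    rw [abs_of_nonneg (by linarith [hP.1 0])]; linarith [hP.le_one 0]
  unfold genErr
  refine (abs_add_le _ _).trans (add_le_add ((abs_add_le _ _).trans (add_le_add ?_ ?_)) ?_)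
  · rw [abs_mul, abs_of_pos (Real.exp_pos _)]
    refine mul_le_mul hexp ((abs_sub _ _).trans (add_le_add ?_ ?_)) (abs_nonneg _)
      (Real.exp_pos _).le
    · rw [abs_mul, abs_mul, abs_pow, abs_of_nonneg (by positivity : (0 : ℝ) ≤ (N : ℝ) + 1)]
      gcongr
      exact mul_le_of_le_one_right (by positivity) (hp1 _)
    · rw [abs_mul, abs_mul, abs_pow]
      gcongr
      exact (mul_le_of_le_one_right (abs_nonneg _) (hp1 _)).trans hl
  · refine le_trans ?_ (hp.abs_solCoeff_le hν hq hN ht)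
    rw [abs_mul, abs_mul, abs_pow]
    refine (mul_le_of_le_one_left (by positivity) (hp1 0)).trans ?_
    gcongr
  · rw [abs_mul, abs_mul]
    refine mul_le_mul ((mul_le_of_le_one_right (abs_nonneg _) (hp1 _)).trans hl)
      (abs_exp_sub_sum_le ha _) (abs_nonneg _) (by positivity)

theorem tendsto_genErr_bound (ν B : ℝ) {ρ : ℝ} (h0 : 0 ≤ ρ) (h1 : ρ < 1) :
    Tendsto (fun N : ℕ => Real.exp (2 * ν) * (((N : ℝ) + 1) * ρ ^ N + (ν + 1) * ρ ^ (N + 1))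
      + √(4 * B * ((4 * ν) ^ N / (N.factorial : ℝ)))
      + (ν + 1) * (Real.exp (2 * ν)
        - ∑ j ∈ Finset.range (N + 1), (2 * ν) ^ j / (j.factorial : ℝ))) atTop (𝓝 0) := by
  have e1 := tendsto_self_mul_const_pow_of_lt_one h0 h1
  have e2 := tendsto_pow_atTop_nhds_zero_of_lt_one h0 h1
  have e3 := (e2.comp (tendsto_add_atTop_nat 1)).const_mul (ν + 1)
  have e4 := (FloorSemiring.tendsto_pow_div_factorial_atTop (4 * ν)).const_mul (4 * B)
  have e5 := (tendsto_exp_sub_sum (2 * ν)).const_mul (ν + 1)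
  have h := ((((e1.add e2).add e3).const_mul (Real.exp (2 * ν))).add
    ((Real.continuous_sqrt.tendsto _).comp e4)).add e5
  simp only [mul_zero, add_zero, Real.sqrt_zero] at h
  refine h.congr fun N => ?_
  simp only [Function.comp_apply]
  ring

/-- The generating function of a solution has the expansion given by `solCoeff`. -/
theorem IsSolution.tendsto_genDiff (hν : 0 < ν) (hp : IsSolution (ν + 1) p)
    (hm : p 0 ∈ probWithMean (ν + 1)) (hq : Summable fun k => p 0 (k + 1) ^ 2 / pois ν k)
    {T z : ℝ} (hT : 0 ≤ T) (hz : |z| < 1) :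
    Tendsto (fun N => genDiff ν p (fun s => (z - 1) * Real.exp (s - T)) N T) atTop (𝓝 0) := by
  set ρ := 1 - Real.exp (-T) * (1 - |z|) with hρ
  have hρ1 : ρ < 1 := by
    have := mul_pos (Real.exp_pos (-T)) (sub_pos.2 hz)
    linarith
  have hρ0 : 0 ≤ ρ := (abs_nonneg _).trans (abs_charPoint_le hz hT le_rfl).1
  have hw : ∀ t, HasDerivWithinAt (fun s => (z - 1) * Real.exp (s - T))
      ((z - 1) * Real.exp (t - T)) (Set.Ici 0) t := fun t => by
    have h := (((hasDerivAt_id t).sub_const T).exp).const_mul (z - 1)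
    simp only [id_eq, mul_one] at h
    exact h.hasDerivWithinAt
  -- The Grönwall constant 2 bounds |x w|.
  refine tendsto_zero_of_abs_deriv_le two_ne_zero hT
    (fun N t ht => hp.hasDeriv_genDiff ht (hw t) N) ?_ ?_
    (tendsto_genErr_bound ν (energyConst ν (∑' k, p 0 (k + 1) ^ 2 / pois ν k)) hρ0 hρ1)
  · filter_upwards [eventually_ge_atTop 2] with N hN t ht htT
    obtain ⟨h1, h2⟩ := abs_charPoint_le hz ht htT
    refine (abs_add_le _ _).trans (add_le_add ?_ (hp.abs_genErr_le hν hq ht h2 h1 hN))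
    rw [abs_mul, abs_mul]
    have hP := hp.isProb t ht
    have h3 : |p t 0| ≤ 1 := by rw [abs_of_nonneg (hP.1 0)]; exact hP.le_one 0
    gcongr
    exact (mul_le_of_le_one_left (abs_nonneg _) h3).trans h2
  -- At time 0 both truncated series converge to the same value by the Charlier expansion of the
  -- data.
  · set w0 := (z - 1) * Real.exp (0 - T) with hw0
    obtain ⟨h1, -⟩ := abs_charPoint_le hz le_rfl hT
    have hs := (hp.isProb 0 le_rfl).summable_mul_pow (h1.trans hρ1.le)
    have e1 := (hs.hasSum.tendsto_sum_nat.comp (tendsto_add_atTop_nat 1)).const_mul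
      (Real.exp (-(ν * w0)))
    have e2 := hasSum_charlierCoeff_mul_pow hν hq (1 + w0)
    rw [add_sub_cancel_left] at e2
    have h := e1.sub (e2.tendsto_sum_nat.comp (tendsto_add_atTop_nat 1))
    rw [sub_self] at h
    refine h.congr fun N => ?_
    simp only [genDiff, Function.comp_apply, solCoeff_zero hν hp hm, ← hw0]

/-- Finiteness of the norm at time T is a conclusion here: a sequence is built from the
coefficients, then shown to be the solution minus the Poisson law. -/
theorem IsSolution.hasSum_sq_sub_div_pois (hν : 0 < ν) (hp : IsSolution (ν + 1) p)
    (hm : p 0 ∈ probWithMean (ν + 1)) (hq : Summable fun k => p 0 (k + 1) ^ 2 / pois ν k)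
    {T : ℝ} (hT : 0 ≤ T) :
    ∃ a, HasSum (fun k => (p T (k + 1) - pois ν k) ^ 2 / pois ν k) a ∧
      a ≤ p T 0 ^ 2 + (ν + 1) ^ 2 / ν * p T 0 ^ 2
        + energyConst ν (∑' k, p 0 (k + 1) ^ 2 / pois ν k) * Real.exp (-(min ν 2 * T)) := by
  set B := energyConst ν (∑' k, p 0 (k + 1) ^ 2 / pois ν k)
  -- The Poisson law has the single coefficient 1, in degree zero.
  set c : ℕ → ℝ := fun j => solCoeff ν p j T - if j = 0 then 1 else 0 with hc
  have hpos : ∀ j, 0 ≤ charlierSq ν j * c j ^ 2 := fun j =>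
    mul_nonneg (charlierSq_pos hν j).le (sq_nonneg _)
  have hpart : ∀ n, ∑ j ∈ Finset.range n, charlierSq ν j * c j ^ 2
      ≤ p T 0 ^ 2 + (ν + 1) ^ 2 / ν * p T 0 ^ 2 + B * Real.exp (-(min ν 2 * T)) := by
    intro n
    have h1 : ∑ j ∈ Finset.range n, charlierSq ν j * c j ^ 2
        ≤ ∑ j ∈ Finset.range (n + 2), charlierSq ν j * c j ^ 2 :=
      Finset.sum_le_sum_of_subset_of_nonneg (Finset.range_mono (by omega)) fun j _ _ => hpos j
    rw [Finset.sum_range_succ', Finset.sum_range_succ'] at h1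
    have h2 := hp.energy_solCoeff_le hν hq n hT
    have h3 : ∑ j ∈ Finset.range n, charlierSq ν (j + 1 + 1) * c (j + 1 + 1) ^ 2
        = energy ν n (fun j => solCoeff ν p j T) := by
      simp [energy, hc, add_assoc]
    have h4 : charlierSq ν (0 + 1) * c (0 + 1) ^ 2 = (ν + 1) ^ 2 / ν * p T 0 ^ 2 := by
      simp [hc, solCoeff, coeffCurve, charlierSq]; ring
    have h5 : charlierSq ν 0 * c 0 ^ 2 = p T 0 ^ 2 := by
      simp [hc, solCoeff, coeffCurve, charlierSq]
    rw [h3, h4, h5] at h1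
    linarith
  obtain ⟨r, hr, hrz⟩ := exists_hasSum_sq_div_pois hν
    (summable_of_sum_range_le hpos hpart)
  -- Both sequences have the same generating function on |z| < 1, so they agree term by term.
  have key : (fun k => p T (k + 1)) = fun k => r k + pois ν k := by
    refine eq_of_hasSum_pow (f := fun z => ∑' k, p T (k + 1) * z ^ k)
      (fun z hz => ((hp.isProb T hT).summable_mul_pow hz.le).hasSum) (fun z hz => ?_)
    obtain ⟨hcs, hrs⟩ := hrz z
    have hs := ((hp.isProb T hT).summable_mul_pow hz.le).hasSum
    have hδ : HasSum (fun j => (if j = 0 then (1 : ℝ) else 0) * (z - 1) ^ j) 1 := by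
      have h := hasSum_ite_eq (0 : ℕ) (1 : ℝ)
      exact hasSum_of_forall_eq h (fun j => by by_cases hj : j = 0 <;> simp [hj]) rfl
    have e2 := hcs.hasSum.add hδ
    have h := ((hs.tendsto_sum_nat.comp (tendsto_add_atTop_nat 1)).const_mul
      (Real.exp (-(ν * (z - 1))))).sub (e2.tendsto_sum_nat.comp (tendsto_add_atTop_nat 1))
    have h' := hp.tendsto_genDiff hν hm hq hT hz
    have heq := tendsto_nhds_unique (h.congr fun N => by
      simp only [genDiff, Function.comp_apply, hc, sub_self, Real.exp_zero, mul_one,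
        add_sub_cancel, ← add_mul, sub_add_cancel]) h'
    refine hasSum_of_forall_eq (hrs.add (hasSum_pois_mul_pow ν z)) (fun k => by ring) ?_
    have e3 : Real.exp (ν * (z - 1)) * Real.exp (-(ν * (z - 1))) = 1 := by
      rw [← Real.exp_add]; simp
    linear_combination Real.exp (ν * (z - 1)) * heq - (∑' k, p T (k + 1) * z ^ k) * e3
  refine ⟨_, hasSum_of_forall_eq hr (fun k => ?_) rfl, Real.tsum_le_of_sum_range_le hpos hpart⟩
  rw [show p T (k + 1) = r k + pois ν k from congrFun key k, add_sub_cancel_right]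

/-! ### Return to the weighted norm -/

theorem pbar_succ (ν : ℝ) (k : ℕ) : pbar (ν + 1) (k + 1) = pois ν k := by
  simp [pbar, pois]

theorem normH_sq (hν : 0 < ν) (f : ℕ → ℝ) :
    normH (ν + 1) f ^ 2 = f 0 ^ 2 + ∑' k, f (k + 1) ^ 2 / pois ν k := by
  have e : innerH (ν + 1) f f = f 0 ^ 2 + ∑' k, f (k + 1) ^ 2 / pois ν k := by
    simp only [innerH, pbar_succ, sq]
  rw [normH, e, Real.sq_sqrt]
  exact add_nonneg (sq_nonneg _)
    (tsum_nonneg fun k => div_nonneg (sq_nonneg _) (pois_pos hν k).le)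

theorem mem_spaceH (hν : 0 < ν) {f : ℕ → ℝ}
    (hf : Summable fun k => f (k + 1) ^ 2 / pois ν k) : f ∈ spaceH (ν + 1) := by
  refine ⟨memℓp_gen ?_, by simpa only [pbar_succ] using hf⟩
  rw [← summable_nat_add_iff 1]
  refine Summable.of_nonneg_of_le (fun k => by positivity) (fun k => ?_) hf
  have h1 := pois_pos hν k
  have h2 : pois ν k ≤ 1 := le_hasSum (hasSum_pois ν) k fun j _ => (pois_pos hν j).le
  rw [le_div_iff₀ h1]
  simpa using mul_le_of_le_one_right (sq_nonneg (f (k + 1))) h2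

theorem energyConst_mono (hν : 0 < ν) {B B' : ℝ} (h : B ≤ B') :
    energyConst ν B ≤ energyConst ν B' := by
  unfold energyConst
  gcongr

theorem energyConst_nonneg (hν : 0 < ν) {B : ℝ} (h : 0 ≤ B) : 0 ≤ energyConst ν B := by
  unfold energyConst
  positivity

theorem tsum_sq_div_pois_le (hν : 0 < ν) {q : ℕ → ℝ}
    (hq : Summable fun k => q k ^ 2 / pois ν k)
    (hd : Summable fun k => (q k - pois ν k) ^ 2 / pois ν k) :
    ∑' k, q k ^ 2 / pois ν k ≤ 2 * (∑' k, (q k - pois ν k) ^ 2 / pois ν k) + 2 := by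
  have h := (hd.hasSum.mul_left 2).add ((hasSum_pois ν).mul_left 2)
  rw [mul_one] at h
  refine hasSum_le (fun k => ?_) hq.hasSum h
  have h1 := pois_pos hν k
  rw [← sub_nonneg]
  have e : 2 * ((q k - pois ν k) ^ 2 / pois ν k) + 2 * pois ν k - q k ^ 2 / pois ν k
      = (q k - 2 * pois ν k) ^ 2 / pois ν k := by
    field_simp
    ring
  rw [e]
  positivity

/-- Exponential decay with rate `min ν 2`, uniformly on balls of initial data. -/
theorem IsSolution.normH_sq_le (hν : 0 < ν) (hp : IsSolution (ν + 1) p)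
    (hm : p 0 ∈ probWithMean (ν + 1)) (h0 : p 0 ∈ spaceH (ν + 1)) {R : ℝ}
    (hR : normH (ν + 1) (p 0 - pbar (ν + 1)) ≤ R) {t : ℝ} (ht : 0 ≤ t) :
    p t - pbar (ν + 1) ∈ spaceH (ν + 1) ∧
      normH (ν + 1) (p t - pbar (ν + 1)) ^ 2
        ≤ (2 + (ν + 1) ^ 2 / ν + energyConst ν (2 * R ^ 2 + 2)) * Real.exp (-(min ν 2 * t)) := by
  have hq : Summable fun k => p 0 (k + 1) ^ 2 / pois ν k := by
    simpa only [pbar_succ] using h0.2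
  have hd : ∀ s k, (p s - pbar (ν + 1)) (k + 1) = p s (k + 1) - pois ν k := fun s k => by
    rw [Pi.sub_apply, pbar_succ]
  have hd0 : ∀ s, (p s - pbar (ν + 1)) 0 = p s 0 := fun s => by simp [pbar]
  obtain ⟨a, ha, hle⟩ := hp.hasSum_sq_sub_div_pois hν hm hq ht
  -- Time 0 is used only for summability of the initial deviation; without it the `tsum` in the norm
  -- could be the default 0.
  obtain ⟨b, hb, -⟩ := hp.hasSum_sq_sub_div_pois hν hm hq le_rfl
  refine ⟨mem_spaceH hν (by simpa only [hd] using ha.summable), ?_⟩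
  have hB : ∑' k, p 0 (k + 1) ^ 2 / pois ν k ≤ 2 * R ^ 2 + 2 := by
    have h1 : normH (ν + 1) (p 0 - pbar (ν + 1)) ^ 2 ≤ R ^ 2 :=
      pow_le_pow_left₀ (Real.sqrt_nonneg _) hR 2
    rw [normH_sq hν] at h1
    simp only [hd, hd0] at h1
    linarith [tsum_sq_div_pois_le hν hq hb.summable, sq_nonneg (p 0 0)]
  rw [normH_sq hν]
  simp only [hd, hd0, ha.tsum_eq]
  have hx : p t 0 ^ 2 ≤ Real.exp (-(min ν 2 * t)) := by
    have h1 := le_exp_of_logistic ((hp.isProb 0 le_rfl).le_one 0)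
      (fun t ht => hp.hasDeriv_zero ht) ht
    refine (pow_le_pow_left₀ ((hp.isProb t ht).1 0) h1 2).trans ?_
    rw [← Real.exp_nat_mul]
    apply Real.exp_le_exp.2
    push_cast
    nlinarith [mul_le_mul_of_nonneg_right (min_le_left ν 2) ht, mul_nonneg hν.le ht]
  have hE := mul_le_mul_of_nonneg_right (energyConst_mono hν hB)
    (Real.exp_pos (-(min ν 2 * t))).le
  have hk : (ν + 1) ^ 2 / ν * p t 0 ^ 2 ≤ (ν + 1) ^ 2 / ν * Real.exp (-(min ν 2 * t)) := by
    gcongr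
  linarith

end StickyDispersion

end

theorem mainTheorem3 (μ : ℝ) (hμ : 1 < μ) (R : ℝ) :
    ∃ C : ℝ, 0 < C ∧
      ∀ p : ℝ → ℕ → ℝ, StickyDispersion.IsSolution μ p →
        p 0 ∈ StickyDispersion.probWithMean μ →
        p 0 ∈ StickyDispersion.spaceH μ →
        StickyDispersion.normH μ (p 0 - StickyDispersion.pbar μ) ≤ R →
        (∀ t : ℝ, 0 ≤ t →
          p t - StickyDispersion.pbar μ ∈ StickyDispersion.spaceH μ ∧
          (μ < 3 → StickyDispersion.normH μ (p t - StickyDispersion.pbar μ) ^ 2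
            ≤ C * (1 + t) * Real.exp (-(μ - 1) * t)) ∧
          (μ = 3 → StickyDispersion.normH μ (p t - StickyDispersion.pbar μ) ^ 2
            ≤ C * (1 + t) ^ 2 * Real.exp (-2 * t)) ∧
          (3 < μ → StickyDispersion.normH μ (p t - StickyDispersion.pbar μ) ^ 2
            ≤ C * Real.exp (-2 * t))) ∧
        Tendsto (fun t => StickyDispersion.normH μ (p t - StickyDispersion.pbar μ)) atTop (𝓝 0) := by
  obtain ⟨ν, rfl⟩ : ∃ ν, μ = ν + 1 := ⟨μ - 1, by ring⟩
  have hν : 0 < ν := by linarith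
  -- The 2 counts p_0² twice: once in the norm itself, once through the degree-zero coefficient
  -- -p_0.
  set C := 2 + (ν + 1) ^ 2 / ν + StickyDispersion.energyConst ν (2 * R ^ 2 + 2) with hC
  have hC0 : 0 < C := by
    have := StickyDispersion.energyConst_nonneg hν (by positivity : 0 ≤ 2 * R ^ 2 + 2)
    positivity
  refine ⟨C, hC0, fun p hp hm h0 hR => ⟨fun t ht => ?_, ?_⟩⟩
  · obtain ⟨hmem, hle⟩ := hp.normH_sq_le hν hm h0 hR ht
    refine ⟨hmem, fun h => ?_, fun h => ?_, fun h => ?_⟩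
    · rw [min_eq_left (by linarith)] at hle
      rw [add_sub_cancel_right, neg_mul]
      refine hle.trans (mul_le_mul_of_nonneg_right ?_ (Real.exp_pos _).le)
      -- The bound already holds without the polynomial factor, which is at least 1.
      exact le_mul_of_one_le_right hC0.le (by linarith)
    · rw [min_eq_right (by linarith)] at hle
      rw [neg_mul]
      refine hle.trans (mul_le_mul_of_nonneg_right ?_ (Real.exp_pos _).le)
      exact le_mul_of_one_le_right hC0.le (one_le_pow₀ (by linarith))
    · rw [min_eq_right (by linarith)] at hle
      rwa [neg_mul]
  · have hm0 : 0 < min ν 2 := lt_min hν two_pos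
    have hlim : Tendsto (fun t => √(C * Real.exp (-(min ν 2 * t)))) atTop (𝓝 0) := by
      have h1 := ((Real.tendsto_exp_neg_atTop_nhds_zero.comp
        (tendsto_id.const_mul_atTop hm0)).const_mul C).sqrt
      simpa using h1
    refine squeeze_zero' (Eventually.of_forall fun t => Real.sqrt_nonneg _) ?_ hlim
    filter_upwards [eventually_ge_atTop 0] with t ht
    exact Real.le_sqrt_of_sq_le (hp.normH_sq_le hν hm h0 hR ht).2
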